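/- Let $m\ge 0$, let $n_1,\dots,n_m\ge 1$ be integers, and for $1\le k\le m$, $0\le \ell\le m$ let $A_{k\ell}\in\mathbb C^{n_k\times n_k}$ be Hermitian matrices. For $\lambda=(\lambda_1,\dots,\lambda_m)\in\mathbb R^m$ put $M_k(\lambda)=A_{k0}+\sum_{\ell=1}^m\lambda_\ell A_{k\ell}$. Let $\mathbf i=(i_1,\dots,i_m)$ with $1\le i_k\le n_k$, let $\varepsilon_{k,i_k}(\lambda)$ be the $i_k$-th largest eigenvalue of $M_k(\lambda)$, counted with multiplicity, and define $$F_{\mathbf i}\colon\mathbb R^m\to\mathbb R^m,\qquad F_{\mathbf i}(\lambda)=(\varepsilon_{1,i_1}(\lambda),\dots,\varepsilon_{m,i_m}(\lambda)).$$ For $\lambda\in\mathbb R^m$ let $E(\lambda)$ be the set of tuples $u=(u_1,\dots,u_m)$ such that each $u_k\in\mathbb C^{n_k}$ is a Euclidean unit vector with $M_k(\lambda)u_k=\varepsilon_{k,i_k}(\lambda)u_k$, and for such $u$ let $J(u)=\bigl[u_k^{\mathsf H}A_{k\ell}u_k\bigr]_{k,\ell=1}^m\in\mathbb R^{m\times m}$.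 For a Lipschitz continuous function $\Phi\colon\mathbb R^m\to\mathbb R^m$, Clarke's generalized Jacobian $\partial\Phi(\lambda)$ is the convex hull of all matrices $J$ for which there is a sequence $\lambda^{(j)}\to\lambda$ of points at which $\Phi$ is differentiable with $\Phi'(\lambda^{(j)})\to J$. Then: 1. $F_{\mathbf i}$ is Lipschitz continuous (so that $\partial F_{\mathbf i}$ is defined). 2. If, for every $k$, the multiplicity of the eigenvalue $\varepsilon_{k,i_k}(\cdot)$ of $M_k(\cdot)$ is constant in a neighborhood of $\lambda$, then $F_{\mathbf i}$ is differentiable at $\lambda$, and its Jacobian is $F_{\mathbf i}'(\lambda)=J(u)$ for every $u\in E(\lambda)$. 3. For every $\lambda\in\mathbb R^m$ (in particular where the condition in 2 fails), $\partial F_{\mathbf i}(\lambda)\subseteq\operatorname{conv}\{J(u): u\in E(\lambda)\}$. -/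

import Mathlib

open Filter Topology
open scoped Matrix

noncomputable section

namespace MEP

/-- The matrix `A_{k0} + ∑_{ℓ=1}^m λ_ℓ A_{kℓ}`, i.e. `∑_{ℓ=0}^m λ_ℓ A_{kℓ}` with `λ_0 = 1`.
The parameter `λ_ℓ` with `1 ≤ ℓ ≤ m` is the coordinate of `x` of index `ℓ - 1 : Fin m`. -/
def pencil {m : ℕ} {n : Fin m → ℕ}
    (A : (k : Fin m) → Fin (m + 1) → Matrix (Fin (n k)) (Fin (n k)) ℂ)
    (k : Fin m) (x : EuclideanSpace ℝ (Fin m)) : Matrix (Fin (n k)) (Fin (n k)) ℂ :=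
  A k 0 + ∑ l : Fin m, (x l : ℂ) • A k l.succ

theorem isHermitian_pencil {m : ℕ} {n : Fin m → ℕ}
    {A : (k : Fin m) → Fin (m + 1) → Matrix (Fin (n k)) (Fin (n k)) ℂ}
    (hA : ∀ k l, (A k l).IsHermitian) (k : Fin m) (x : EuclideanSpace ℝ (Fin m)) :
    (pencil A k x).IsHermitian := by
  unfold pencil Matrix.IsHermitian
  rw [Matrix.conjTranspose_add, Matrix.conjTranspose_sum, (hA k 0).eq]
  congr 1
  refine Finset.sum_congr rfl fun l _ => ?_
  rw [Matrix.conjTranspose_smul, (hA k l.succ).eq]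
  simp

/-- The `i`-th largest eigenvalue of `pencil A k x`, counted with multiplicity; the count starts
at `0`, so that `i = 0` is the largest eigenvalue and `i = n k - 1` the smallest. -/
def eps {m : ℕ} {n : Fin m → ℕ}
    {A : (k : Fin m) → Fin (m + 1) → Matrix (Fin (n k)) (Fin (n k)) ℂ}
    (hA : ∀ k l, (A k l).IsHermitian) (k : Fin m) (i : Fin (n k))
    (x : EuclideanSpace ℝ (Fin m)) : ℝ :=
  (isHermitian_pencil hA k x).eigenvalues₀ (Fin.cast (Fintype.card_fin (n k)).symm i)

/-- The function `F_𝐢 : ℝ^m → ℝ^m` of the multiindex `𝐢`. -/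
def F {m : ℕ} {n : Fin m → ℕ}
    {A : (k : Fin m) → Fin (m + 1) → Matrix (Fin (n k)) (Fin (n k)) ℂ}
    (hA : ∀ k l, (A k l).IsHermitian) (i : (k : Fin m) → Fin (n k))
    (x : EuclideanSpace ℝ (Fin m)) : EuclideanSpace ℝ (Fin m) :=
  WithLp.toLp 2 fun k => eps hA k (i k) x

/-- The multiplicity of `eps hA k i x` as an eigenvalue of `pencil A k x`: the dimension of its
eigenspace. -/
def multiplicity {m : ℕ} {n : Fin m → ℕ}
    {A : (k : Fin m) → Fin (m + 1) → Matrix (Fin (n k)) (Fin (n k)) ℂ}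
    (hA : ∀ k l, (A k l).IsHermitian) (k : Fin m) (i : Fin (n k))
    (x : EuclideanSpace ℝ (Fin m)) : ℕ :=
  Module.finrank ℂ
    (Module.End.eigenspace (Matrix.toLin' (pencil A k x)) ((eps hA k i x : ℝ) : ℂ))

/-- `u = (u_1, …, u_m)` consists of Euclidean unit vectors, `u_k` being an eigenvector of
`pencil A k x` for the eigenvalue `eps hA k (i k) x`. -/
def IsUnitEigenvectors {m : ℕ} {n : Fin m → ℕ}
    {A : (k : Fin m) → Fin (m + 1) → Matrix (Fin (n k)) (Fin (n k)) ℂ}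
    (hA : ∀ k l, (A k l).IsHermitian) (i : (k : Fin m) → Fin (n k))
    (x : EuclideanSpace ℝ (Fin m)) (u : (k : Fin m) → EuclideanSpace ℂ (Fin (n k))) : Prop :=
  ∀ k, ‖u k‖ = 1 ∧
    pencil A k x *ᵥ (u k).ofLp = ((eps hA k (i k) x : ℝ) : ℂ) • (u k).ofLp

/-- The `m × m` matrix with entries `u_kᴴ A_{kℓ} u_k`, `1 ≤ k, ℓ ≤ m`. These numbers are real
when the `A_{kℓ}` are Hermitian, so taking the real part only changes the type. -/
def formMatrix {m : ℕ} {n : Fin m → ℕ}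
    (A : (k : Fin m) → Fin (m + 1) → Matrix (Fin (n k)) (Fin (n k)) ℂ)
    (u : (k : Fin m) → EuclideanSpace ℂ (Fin (n k))) : Matrix (Fin m) (Fin m) ℝ :=
  Matrix.of fun k l => (star (u k).ofLp ⬝ᵥ (A k l.succ *ᵥ (u k).ofLp)).re

end MEP

/-- The Jacobian matrix `Φ'(x)`, meaningful where `Φ` is differentiable. -/
def jacobianMatrix {p q : ℕ} (Φ : EuclideanSpace ℝ (Fin q) → EuclideanSpace ℝ (Fin p))
    (x : EuclideanSpace ℝ (Fin q)) : Matrix (Fin p) (Fin q) ℝ :=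
  Matrix.of fun k l => (fderiv ℝ Φ x (EuclideanSpace.single l 1)) k

/-- Clarke's generalized Jacobian `∂Φ(x)` of a Lipschitz function: the convex hull of all limits
of Jacobian matrices along sequences of points of differentiability that tend to `x`. -/
def clarkeJacobian {p q : ℕ} (Φ : EuclideanSpace ℝ (Fin q) → EuclideanSpace ℝ (Fin p))
    (x : EuclideanSpace ℝ (Fin q)) : Set (Matrix (Fin p) (Fin q) ℝ) :=
  convexHull ℝ {J | ∃ y : ℕ → EuclideanSpace ℝ (Fin q),
    (∀ j, DifferentiableAt ℝ Φ (y j)) ∧ Tendsto y atTop (𝓝 x) ∧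
    Tendsto (fun j => jacobianMatrix Φ (y j)) atTop (𝓝 J)}

end

/-! Row `k` of the Jacobian involves only the `k`-th pencil, an affine family `T` of symmetric
operators with linear part `B`, so everything reduces to one eigenvalue λ of such a family.

Upper bounds come from one comparison vector. A dimension count (`exists_unit_eigenvalues_le`) gives
a unit `u` with ⟨u, T x u⟩ ≤ λ(x) and λ(y) ≤ ⟨u, T y u⟩, hence λ(y) - λ(x) ≤ ⟨u, B(y - x)u⟩. This
yields the Lipschitz bound. For y = x + td with t ↓ 0, a limit of the vectors `u` is a unit
eigenvector at `x`, and its form dominates the derivative in direction `d`. The domination survives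
limits of gradients. As the vector depends on `d`, Hahn–Banach places the limit row only in the
convex hull of the eigenvector rows. Rows combine because the `u_k` are chosen independently and the
hull of a product contains the product of the hulls.

With locally constant multiplicity, a unit eigenvector `u` at `x` is a limit of eigenvectors w(y) at
y. Evaluating ⟨w(y), T y u⟩ in two ways gives ⟨w(y), B(y - x)u⟩ = (λ(y) - λ(x))⟨w(y), u⟩, and w(y) →
u gives the derivative without differentiating eigenvectors. -/

/-! ### Convex hulls of compact sets -/

/-- In a finite-dimensional space the convex hull of a compact set is compact. -/
theorem IsCompact.convexHull_of_finiteDimensional {V : Type*} [NormedAddCommGroup V]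
    [NormedSpace ℝ V] [FiniteDimensional ℝ V] {s : Set V} (hs : IsCompact s) :
    IsCompact (convexHull ℝ s) := by
  -- Carathéodory: at most dim V + 1 points are needed, so the hull is a finite union of continuous
  -- images of compact sets.
  have key : convexHull ℝ s = ⋃ k ∈ Finset.range (Module.finrank ℝ V + 2),
      (fun p : (Fin k → ℝ) × (Fin k → V) => ∑ i, p.1 i • p.2 i) ''
        (stdSimplex ℝ (Fin k) ×ˢ Set.univ.pi fun _ => s) := by
    apply Set.Subset.antisymm
    · intro v hv
      obtain ⟨ι, _, z, w, hz, hai, hw, hw1, hv⟩ := eq_pos_convex_span_of_mem_convexHull hv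
      have hcard := hai.card_le_finrank_succ
      have hle := Submodule.finrank_le (vectorSpan ℝ (Set.range z))
      let e := Fintype.equivFin ι
      simp only [Set.mem_iUnion, Finset.mem_range]
      refine ⟨Fintype.card ι, by omega, (w ∘ e.symm, z ∘ e.symm), ⟨⟨fun i => (hw _).le, ?_⟩, ?_⟩, ?_⟩
      · simpa using (e.symm.sum_comp w).trans hw1
      · exact fun i _ => hz ⟨_, rfl⟩
      · simpa using (e.symm.sum_comp fun i => w i • z i).trans hv
    · simp only [Set.iUnion_subset_iff]
      rintro k - _ ⟨⟨w, z⟩, ⟨hw, hz⟩, rfl⟩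
      exact (convex_convexHull ℝ s).sum_mem (fun i _ => hw.1 i) hw.2
        fun i _ => subset_convexHull ℝ s (hz i trivial)
  rw [key]
  refine Finset.isCompact_biUnion _ fun k _ => IsCompact.image ?_ (by fun_prop)
  exact (isCompact_stdSimplex ℝ _).prod (isCompact_univ_pi fun _ => hs)

/-- A point all of whose linear functionals are dominated by values on a compact set lies in the
convex hull of that set. -/
theorem mem_convexHull_of_forall_exists_le {m : ℕ} {s : Set (Fin m → ℝ)} (hs : IsCompact s)
    {c : Fin m → ℝ} (h : ∀ d : Fin m → ℝ, ∃ v ∈ s, ∑ l, d l * c l ≤ ∑ l, d l * v l) :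
    c ∈ convexHull ℝ s := by
  by_contra hc
  obtain ⟨f, r, hf, hr⟩ := geometric_hahn_banach_closed_point (convex_convexHull ℝ s)
    hs.convexHull_of_finiteDimensional.isClosed hc
  have hsum (v : Fin m → ℝ) : f v = ∑ l, f (Pi.single l 1) * v l := by
    conv_lhs => rw [pi_eq_sum_univ' v, map_sum]
    refine Finset.sum_congr rfl fun l _ => ?_
    rw [map_smul, smul_eq_mul, mul_comm]
  obtain ⟨v, hv, hle⟩ := h fun l => f (Pi.single l 1)
  rw [← hsum, ← hsum] at hle
  linarith [hf v (subset_convexHull ℝ s hv)]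

theorem OrthonormalBasis.sum_norm_sq_repr {ι 𝕜 E : Type*} [Fintype ι] [RCLike 𝕜]
    [NormedAddCommGroup E] [InnerProductSpace 𝕜 E] (b : OrthonormalBasis ι 𝕜 E) (u : E) :
    ∑ j, ‖b.repr u j‖ ^ 2 = ‖u‖ ^ 2 := by
  rw [← b.repr.norm_map u, EuclideanSpace.norm_sq_eq]

/-! ### Comparison of eigenvalues of symmetric operators -/

namespace LinearMap.IsSymmetric

variable {𝕜 E : Type*} [RCLike 𝕜] [NormedAddCommGroup E] [InnerProductSpace 𝕜 E]
  [FiniteDimensional 𝕜 E] {S T : E →ₗ[𝕜] E} {n : ℕ}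

local notation "⟪" x ", " y "⟫" => inner 𝕜 x y

theorem re_inner_apply_eq_sum (hT : T.IsSymmetric) (hn : Module.finrank 𝕜 E = n) (u : E) :
    RCLike.re ⟪u, T u⟫ =
      ∑ j, hT.eigenvalues hn j * ‖(hT.eigenvectorBasis hn).repr u j‖ ^ 2 := by
  rw [← (hT.eigenvectorBasis hn).repr.inner_map_map, PiLp.inner_apply, map_sum]
  refine Finset.sum_congr rfl fun j _ => ?_
  rw [hT.eigenvectorBasis_apply_self_apply, RCLike.inner_apply, mul_assoc, RCLike.mul_conj]
  norm_cast

/-- Two decreasing orthonormal eigenbases: some unit vector lies in the span of the eigenvectors of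
`S` of index at least `i` and in the span of the eigenvectors of `T` of index at most `i`. -/
theorem exists_unit_eigenvalues_le (hS : S.IsSymmetric) (hT : T.IsSymmetric)
    (hn : Module.finrank 𝕜 E = n) (i : Fin n) :
    ∃ u : E, ‖u‖ = 1 ∧ (∀ j < i, (hS.eigenvectorBasis hn).repr u j = 0) ∧
      hT.eigenvalues hn i ≤ RCLike.re ⟪u, T u⟫ := by
  classical
  -- One linear condition for each index except `i`: n - 1 conditions in dimension n leave a nonzero
  -- vector.
  let L : E →ₗ[𝕜] ({j : Fin n // j ≠ i} → 𝕜) := LinearMap.pi fun j =>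
    if j.1 < i then (EuclideanSpace.proj j.1 : EuclideanSpace 𝕜 (Fin n) →L[𝕜] 𝕜).toLinearMap ∘ₗ
        (hS.eigenvectorBasis hn).repr.toLinearEquiv.toLinearMap
    else (EuclideanSpace.proj j.1 : EuclideanSpace 𝕜 (Fin n) →L[𝕜] 𝕜).toLinearMap ∘ₗ
        (hT.eigenvectorBasis hn).repr.toLinearEquiv.toLinearMap
  have hker : LinearMap.ker L ≠ ⊥ := by
    apply LinearMap.ker_ne_bot_of_finrank_lt
    rw [Module.finrank_fintype_fun_eq_card, hn, Fintype.card_subtype_compl]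
    have := i.pos
    simp
    omega
  obtain ⟨v, hv, hv0⟩ := Submodule.exists_mem_ne_zero_of_ne_bot hker
  have hvS : ∀ j < i, (hS.eigenvectorBasis hn).repr v j = 0 := fun j hj => by
    have := congrFun (LinearMap.mem_ker.1 hv) ⟨j, hj.ne⟩
    simpa [L, hj] using this
  have hvT : ∀ j > i, (hT.eigenvectorBasis hn).repr v j = 0 := fun j hj => by
    have := congrFun (LinearMap.mem_ker.1 hv) ⟨j, hj.ne'⟩
    simpa [L, not_lt.2 hj.le] using this
  have hnv : ‖v‖ ≠ 0 := norm_ne_zero_iff.2 hv0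
  let c : 𝕜 := ((‖v‖⁻¹ : ℝ) : 𝕜)
  have hu : ‖c • v‖ = 1 := by simp [c, norm_smul, hnv]
  refine ⟨c • v, hu, fun j hj => by simp [hvS j hj], ?_⟩
  rw [hT.re_inner_apply_eq_sum hn]
  calc hT.eigenvalues hn i
      = ∑ j, hT.eigenvalues hn i * ‖(hT.eigenvectorBasis hn).repr (c • v) j‖ ^ 2 := by
        rw [← Finset.mul_sum, OrthonormalBasis.sum_norm_sq_repr, hu]; simp
    _ ≤ _ := by
        refine Finset.sum_le_sum fun j _ => ?_
        rcases le_or_gt j i with h | h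
        · exact mul_le_mul_of_nonneg_right (hT.eigenvalues_antitone hn h) (by positivity)
        · simp [hvT j h]

theorem re_inner_apply_le_of_repr_eq_zero (hT : T.IsSymmetric) (hn : Module.finrank 𝕜 E = n)
    (i : Fin n) {u : E} (hu : ∀ j < i, (hT.eigenvectorBasis hn).repr u j = 0) :
    RCLike.re ⟪u, T u⟫ ≤ hT.eigenvalues hn i * ‖u‖ ^ 2 := by
  rw [hT.re_inner_apply_eq_sum hn, ← OrthonormalBasis.sum_norm_sq_repr (hT.eigenvectorBasis hn), Finset.mul_sum]
  refine Finset.sum_le_sum fun j _ => ?_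
  rcases lt_or_ge j i with h | h
  · simp [hu j h]
  · exact mul_le_mul_of_nonneg_right (hT.eigenvalues_antitone hn h) (by positivity)

/-- The case of equality in `re_inner_apply_le_of_repr_eq_zero`. -/
theorem apply_eq_smul_of_le_re_inner (hT : T.IsSymmetric) (hn : Module.finrank 𝕜 E = n)
    (i : Fin n) {u : E} (hu : ∀ j < i, (hT.eigenvectorBasis hn).repr u j = 0)
    (hle : hT.eigenvalues hn i * ‖u‖ ^ 2 ≤ RCLike.re ⟪u, T u⟫) :
    T u = (hT.eigenvalues hn i : 𝕜) • u := by
  -- These nonnegative terms sum to at most zero, so every coordinate with eigenvalue different from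
  -- the `i`-th vanishes.
  have hnonneg : ∀ j ∈ Finset.univ, 0 ≤ (hT.eigenvalues hn i - hT.eigenvalues hn j) *
      ‖(hT.eigenvectorBasis hn).repr u j‖ ^ 2 := fun j _ => by
    rcases lt_or_ge j i with h | h
    · simp [hu j h]
    · exact mul_nonneg (sub_nonneg.2 (hT.eigenvalues_antitone hn h)) (by positivity)
  have hsum : ∑ j, (hT.eigenvalues hn i - hT.eigenvalues hn j) *
      ‖(hT.eigenvectorBasis hn).repr u j‖ ^ 2 = 0 := by
    refine le_antisymm ?_ (Finset.sum_nonneg hnonneg)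
    simp only [sub_mul, Finset.sum_sub_distrib]
    rw [← Finset.mul_sum, OrthonormalBasis.sum_norm_sq_repr, ← hT.re_inner_apply_eq_sum hn]
    linarith
  have hzero := (Finset.sum_eq_zero_iff_of_nonneg hnonneg).1 hsum
  apply (hT.eigenvectorBasis hn).repr.injective
  ext j
  rw [hT.eigenvectorBasis_apply_self_apply, map_smul, PiLp.smul_apply, smul_eq_mul]
  rcases mul_eq_zero.1 (hzero j (Finset.mem_univ j)) with h | h
  · rw [sub_eq_zero.1 h]
  · simp at h
    simp [h]

end LinearMap.IsSymmetric

/-- Compactness of the sphere; refining a filter to an ultrafilter replaces passing to subsequences.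
-/
theorem Ultrafilter.exists_tendsto_of_norm_eq_one {E α : Type*} [SeminormedAddCommGroup E]
    [ProperSpace E] (U : Ultrafilter α) {u : α → E} (hu : ∀ a, ‖u a‖ = 1) :
    ∃ w, Tendsto u U (𝓝 w) := by
  obtain ⟨w, -, hw⟩ := (isCompact_sphere (0 : E) 1).ultrafilter_le_nhds' (U.map u)
    (Filter.mem_map.2 (Filter.univ_mem' fun a => by simp [hu a]))
  exact ⟨w, hw⟩

/-! ### Eigenvalues of affine families of symmetric operators -/

section AffineFamily

variable {𝕜 E X : Type*} [RCLike 𝕜] [NormedAddCommGroup E] [InnerProductSpace 𝕜 E]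
  [NormedAddCommGroup X] [NormedSpace ℝ X] {n : ℕ}

local notation "⟪" x ", " y "⟫" => inner 𝕜 x y

/-- An affine family of symmetric operators with linear part `B`. -/
structure IsAffineSymmetricFamily [NormedSpace ℝ E] [SMulCommClass 𝕜 ℝ E] (T : X → E →ₗ[𝕜] E)
    (B : X →L[ℝ] (E →L[𝕜] E)) : Prop where
  isSymmetric (x : X) : (T x).IsSymmetric
  apply_sub (x y : X) (v : E) : T y v = T x v + B (y - x) v

namespace IsAffineSymmetricFamily

variable [NormedSpace ℝ E] [SMulCommClass 𝕜 ℝ E] {T : X → E →ₗ[𝕜] E} {B : X →L[ℝ] (E →L[𝕜] E)}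

theorem tendsto_re_inner (B : X →L[ℝ] (E →L[𝕜] E)) {α : Type*} {l : Filter α} {v : α → E} {w : E}
    (d : X) (hv : Tendsto v l (𝓝 w)) :
    Tendsto (fun a => RCLike.re ⟪v a, B d (v a)⟫) l (𝓝 (RCLike.re ⟪w, B d w⟫)) :=
  (RCLike.continuous_re.tendsto _).comp (hv.inner (((B d).continuous.tendsto w).comp hv))

theorem norm_re_inner_le (B : X →L[ℝ] (E →L[𝕜] E)) (d : X) (v w : E) :
    |RCLike.re ⟪v, B d w⟫| ≤ ‖v‖ * (‖B‖ * ‖d‖ * ‖w‖) :=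
  ((RCLike.abs_re_le_norm _).trans (norm_inner_le_norm _ _)).trans <| by
    gcongr
    exact ((B d).le_opNorm w).trans (by gcongr; exact B.le_opNorm d)

variable [FiniteDimensional 𝕜 E]

theorem tendsto_apply (hT : IsAffineSymmetricFamily T B) {α : Type*} {l : Filter α} {y : α → X}
    {v : α → E} {x : X} {w : E} (hy : Tendsto y l (𝓝 x)) (hv : Tendsto v l (𝓝 w)) :
    Tendsto (fun a => T (y a) (v a)) l (𝓝 (T x w)) := by
  have h1 : Tendsto (fun a => T x (v a)) l (𝓝 (T x w)) :=
    ((T x).continuous_of_finiteDimensional.tendsto w).comp hv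
  have h2 : Tendsto (fun a => B (y a - x) (v a)) l (𝓝 (B (x - x) w)) :=
    (isBoundedBilinearMap_apply.continuous.tendsto (B (x - x), w)).comp
      (((B.continuous.tendsto _).comp (hy.sub_const x)).prodMk_nhds hv)
  have h3 := h1.add h2
  rw [← hT.apply_sub x x w] at h3
  exact h3.congr fun a => (hT.apply_sub x (y a) (v a)).symm

/-- The `i`-th largest eigenvalue along the family. -/
noncomputable def eigenvalue (hT : IsAffineSymmetricFamily T B) (hn : Module.finrank 𝕜 E = n)
    (i : Fin n) (x : X) : ℝ :=
  (hT.isSymmetric x).eigenvalues hn i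

variable (hT : IsAffineSymmetricFamily T B) (hn : Module.finrank 𝕜 E = n) (i : Fin n)

/-- The comparison vector for `T x` and `T y` turns the increment of the eigenvalue into a value of
the form of `B (y - x)`. -/
theorem eigenvalue_sub_le (x y : X) :
    hT.eigenvalue hn i y - hT.eigenvalue hn i x ≤ ‖B‖ * ‖y - x‖ := by
  obtain ⟨u, hu, hux, huy⟩ :=
    (hT.isSymmetric x).exists_unit_eigenvalues_le (hT.isSymmetric y) hn i
  have hle := (hT.isSymmetric x).re_inner_apply_le_of_repr_eq_zero hn i hux
  have hB := (abs_le.1 (norm_re_inner_le B (y - x) u u)).2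
  rw [hT.apply_sub x y, inner_add_right, map_add] at huy
  simp only [hu, one_pow, mul_one, one_mul] at hle hB
  unfold eigenvalue
  linarith

theorem lipschitzWith_eigenvalue : LipschitzWith ‖B‖₊ (hT.eigenvalue hn i) :=
  LipschitzWith.of_le_add_mul _ fun x y => by
    have := hT.eigenvalue_sub_le hn i y x
    rw [dist_eq_norm, coe_nnnorm]
    linarith

/-- `u` is a unit eigenvector for the `i`-th largest eigenvalue. -/
def IsUnitEigenvector (x : X) (u : E) : Prop :=
  ‖u‖ = 1 ∧ T x u = (hT.eigenvalue hn i x : 𝕜) • u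

theorem exists_isUnitEigenvector (x : X) : ∃ u, hT.IsUnitEigenvector hn i x u :=
  ⟨(hT.isSymmetric x).eigenvectorBasis hn i, by simp,
    (hT.isSymmetric x).apply_eigenvectorBasis hn i⟩

theorem isUnitEigenvector_of_tendsto {α : Type*} {l : Filter α} [l.NeBot] {y : α → X} {u : α → E}
    {x : X} {w : E} (hy : Tendsto y l (𝓝 x)) (hu : Tendsto u l (𝓝 w))
    (h : ∀ a, hT.IsUnitEigenvector hn i (y a) (u a)) : hT.IsUnitEigenvector hn i x w := by
  refine ⟨tendsto_nhds_unique hu.norm (by simp [(h _).1]), ?_⟩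
  refine tendsto_nhds_unique (hT.tendsto_apply hy hu) ?_
  simp only [(h _).2]
  exact ((RCLike.continuous_ofReal.tendsto _).comp
    (((hT.lipschitzWith_eigenvalue hn i).continuous.tendsto x).comp hy)).smul hu

theorem isCompact_setOf_isUnitEigenvector (x : X) :
    IsCompact {u | hT.IsUnitEigenvector hn i x u} := by
  have : ProperSpace E := FiniteDimensional.proper_rclike 𝕜 E
  refine (isCompact_sphere (0 : E) 1).of_isClosed_subset ?_ fun u hu => by simp [hu.1]
  have h := (T x).continuous_of_finiteDimensional
  exact (isClosed_eq continuous_norm continuous_const).inter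
    (isClosed_eq h (continuous_const_smul _))

/-- Where the `i`-th eigenvalue is differentiable, its derivative in any direction is dominated by
the quadratic form of some unit eigenvector. -/
theorem exists_le_of_hasFDerivAt [IsScalarTower ℝ 𝕜 E] {x : X} {g : X →L[ℝ] ℝ}
    (hg : HasFDerivAt (hT.eigenvalue hn i) g x) (d : X) :
    ∃ u, hT.IsUnitEigenvector hn i x u ∧ g d ≤ RCLike.re ⟪u, B d u⟫ := by
  choose u hu hux huy using fun t : ℝ =>
    (hT.isSymmetric x).exists_unit_eigenvalues_le (hT.isSymmetric (x + t • d)) hn i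
  have : ProperSpace E := FiniteDimensional.proper_rclike 𝕜 E
  let U := Ultrafilter.of (𝓝[>] (0 : ℝ))
  have hU : (U : Filter ℝ) ≤ 𝓝[>] 0 := Ultrafilter.of_le _
  obtain ⟨w, hw⟩ := U.exists_tendsto_of_norm_eq_one hu
  have hline : Tendsto (fun t : ℝ => x + t • d) U (𝓝 x) := by
    have : Tendsto (fun t : ℝ => x + t • d) (𝓝 0) (𝓝 (x + (0 : ℝ) • d)) :=
      (by fun_prop : Continuous fun t : ℝ => x + t • d).tendsto 0
    rw [zero_smul, add_zero] at this
    exact this.mono_left (hU.trans nhdsWithin_le_nhds)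
  have hw1 : ‖w‖ = 1 := tendsto_nhds_unique hw.norm (by simp [hu])
  refine ⟨w, ⟨hw1, (hT.isSymmetric x).apply_eq_smul_of_le_re_inner hn i (fun j hj => ?_) ?_⟩, ?_⟩
  · refine tendsto_nhds_unique (f := fun t => ((hT.isSymmetric x).eigenvectorBasis hn).repr (u t) j)
      (l := (U : Filter ℝ)) ?_ (by simp [hux _ j hj])
    have : Continuous fun v : E => ((hT.isSymmetric x).eigenvectorBasis hn).repr v j := by fun_prop
    exact (this.tendsto w).comp hw
  -- In the limit `huy` gives the reverse Rayleigh inequality at `x`, which forces the equality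
  -- case.
  · rw [hw1, one_pow, mul_one]
    exact le_of_tendsto_of_tendsto'
      (((hT.lipschitzWith_eigenvalue hn i).continuous.tendsto x).comp hline)
      ((RCLike.continuous_re.tendsto _).comp (hw.inner (hT.tendsto_apply hline hw))) huy
  · have hslope := ((hg.hasLineDerivAt d).tendsto_slope_zero_right).mono_left hU
    refine le_of_tendsto_of_tendsto hslope (tendsto_re_inner B d hw) ?_
    filter_upwards [hU self_mem_nhdsWithin] with t ht
    have ht' : 0 < t := ht
    have h1 := huy t
    have h2 := (hT.isSymmetric x).re_inner_apply_le_of_repr_eq_zero hn i (hux t)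
    rw [hT.apply_sub x, inner_add_right, map_add, add_sub_cancel_left, map_smul] at h1
    have h3 : RCLike.re ⟪u t, (t • B d) (u t)⟫ = t * RCLike.re ⟪u t, B d (u t)⟫ := by
      rw [smul_apply, RCLike.real_smul_eq_coe_smul (K := 𝕜), inner_smul_right,
        RCLike.re_ofReal_mul]
    rw [hu, one_pow, mul_one] at h2
    rw [h3] at h1
    rw [smul_eq_mul, inv_mul_le_iff₀ ht']
    unfold eigenvalue
    linarith

/-- The dominating eigenvectors at the points `y j` accumulate at one for `x`, since the eigenvalue
is continuous. -/
theorem exists_le_of_tendsto [IsScalarTower ℝ 𝕜 E] {x : X} {y : ℕ → X} {g : ℕ → X →L[ℝ] ℝ}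
    {d : X} {c : ℝ}
    (hg : ∀ j, HasFDerivAt (hT.eigenvalue hn i) (g j) (y j)) (hy : Tendsto y atTop (𝓝 x))
    (hc : Tendsto (fun j => g j d) atTop (𝓝 c)) :
    ∃ u, hT.IsUnitEigenvector hn i x u ∧ c ≤ RCLike.re ⟪u, B d u⟫ := by
  choose u hu hle using fun j => hT.exists_le_of_hasFDerivAt hn i (hg j) d
  have : ProperSpace E := FiniteDimensional.proper_rclike 𝕜 E
  let U := Ultrafilter.of (atTop : Filter ℕ)
  have hU : (U : Filter ℕ) ≤ atTop := Ultrafilter.of_le _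
  obtain ⟨w, hw⟩ := U.exists_tendsto_of_norm_eq_one fun j => (hu j).1
  exact ⟨w, hT.isUnitEigenvector_of_tendsto hn i (hy.mono_left hU) hw hu,
    le_of_tendsto_of_tendsto' (hc.mono_left hU) (tendsto_re_inner B d hw) hle⟩

/-- If the multiplicity is locally constant, eigenvectors at `x` are limits of eigenvectors at
nearby points. -/
theorem exists_tendsto_eigenvector {x : X}
    (hmult : ∀ᶠ y in 𝓝 x, Module.finrank 𝕜 (Module.End.eigenspace (T y) (hT.eigenvalue hn i y : 𝕜)) =
      Module.finrank 𝕜 (Module.End.eigenspace (T x) (hT.eigenvalue hn i x : 𝕜)))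
    {u : E} (hu : T x u = (hT.eigenvalue hn i x : 𝕜) • u) :
    ∃ w : X → E, Tendsto w (𝓝 x) (𝓝 u) ∧
      ∀ᶠ y in 𝓝 x, T y (w y) = (hT.eigenvalue hn i y : 𝕜) • w y := by
  set r := Module.finrank 𝕜 (Module.End.eigenspace (T x) (hT.eigenvalue hn i x : 𝕜)) with hr
  -- Where the multiplicity is not `r` the frame is zero; the norm bound then holds everywhere, as
  -- compactness requires.
  have hex : ∀ y, ∃ b : Fin r → E, (∀ a, ‖b a‖ ≤ 1) ∧
      (Module.finrank 𝕜 (Module.End.eigenspace (T y) (hT.eigenvalue hn i y : 𝕜)) = r →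
        Orthonormal 𝕜 b ∧ ∀ a, T y (b a) = (hT.eigenvalue hn i y : 𝕜) • b a) := by
    intro y
    by_cases hy : Module.finrank 𝕜 (Module.End.eigenspace (T y) (hT.eigenvalue hn i y : 𝕜)) = r
    · let b := (stdOrthonormalBasis 𝕜
        (Module.End.eigenspace (T y) (hT.eigenvalue hn i y : 𝕜))).reindex (finCongr hy)
      have hb : Orthonormal 𝕜 fun a => (b a : E) :=
        b.orthonormal.comp_linearIsometry (Submodule.subtypeₗᵢ _)
      exact ⟨fun a => b a, fun a => (hb.1 a).le,
        fun _ => ⟨hb, fun a => Module.End.mem_eigenspace_iff.1 (b a).2⟩⟩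
    · exact ⟨0, by simp, fun h => absurd h hy⟩
  choose b hb1 hb using hex
  -- Near `x` this is the orthogonal projection of `u` onto the eigenspace at `y`.
  refine ⟨fun y => ∑ a, ⟪b y a, u⟫ • b y a, ?_, ?_⟩
  · rw [tendsto_iff_ultrafilter]
    intro U hU
    have : ProperSpace E := FiniteDimensional.proper_rclike 𝕜 E
    obtain ⟨b₀, -, hb₀⟩ := (isCompact_univ_pi fun _ : Fin r =>
      isCompact_closedBall (0 : E) 1).ultrafilter_le_nhds' (U.map b)
        (Filter.mem_map.2 (Filter.univ_mem' fun y => by simpa using hb1 y))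
    have hlim (a : Fin r) : Tendsto (fun y => b y a) U (𝓝 (b₀ a)) :=
      (tendsto_pi_nhds.1 (show Tendsto b U (𝓝 b₀) from hb₀)) a
    have hev : ∀ᶠ y in (U : Filter X), Orthonormal 𝕜 (b y) ∧
        ∀ a, T y (b y a) = (hT.eigenvalue hn i y : 𝕜) • b y a :=
      (hmult.filter_mono hU).mono hb
    have hlam : Tendsto (hT.eigenvalue hn i) U (𝓝 (hT.eigenvalue hn i x)) :=
      ((hT.lipschitzWith_eigenvalue hn i).continuous.tendsto x).mono_left hU
    have heig (a : Fin r) : T x (b₀ a) = (hT.eigenvalue hn i x : 𝕜) • b₀ a := by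
      refine tendsto_nhds_unique (hT.tendsto_apply (tendsto_id.mono_right hU) (hlim a)) ?_
      refine Tendsto.congr' (hev.mono fun y hy => (hy.2 a).symm) ?_
      exact ((RCLike.continuous_ofReal.tendsto _).comp hlam).smul (hlim a)
    let b₁ (a : Fin r) : Module.End.eigenspace (T x) (hT.eigenvalue hn i x : 𝕜) :=
      ⟨b₀ a, Module.End.mem_eigenspace_iff.2 (heig a)⟩
    have hb₁ : Orthonormal 𝕜 b₁ := by
      rw [orthonormal_iff_ite]
      intro a c
      refine tendsto_nhds_unique ((hlim a).inner (hlim c)) ?_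
      exact tendsto_const_nhds.congr'
        (hev.mono fun y hy => (orthonormal_iff_ite.1 hy.1 a c).symm)
    -- The limit frame has `r` orthonormal vectors in an eigenspace of dimension `r`, so it spans it
    -- and the projection of `u` tends to `u`.
    have hspan : ⊤ ≤ Submodule.span 𝕜 (Set.range b₁) :=
      (hb₁.linearIndependent.span_eq_top_of_card_eq_finrank' (by simp [hr])).ge
    have hsum := (OrthonormalBasis.mk hb₁ hspan).sum_repr'
      ⟨u, Module.End.mem_eigenspace_iff.2 hu⟩
    have hsum' : ∑ a, ⟪b₀ a, u⟫ • b₀ a = u := by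
      simpa [b₁] using congrArg Subtype.val hsum
    have := tendsto_finsetSum Finset.univ fun a _ =>
      ((hlim a).inner (𝕜 := 𝕜) (tendsto_const_nhds (x := u))).smul (hlim a)
    rw [hsum'] at this
    exact this
  · filter_upwards [hmult] with y hy
    simp only [map_sum, map_smul, Finset.smul_sum, (hb y hy).2]
    exact Finset.sum_congr rfl fun a _ => smul_comm _ _ _

/-- Where the multiplicity is locally constant, every unit eigenvector gives the derivative. -/
theorem hasFDerivAt_eigenvalue {x : X}
    (hmult : ∀ᶠ y in 𝓝 x, Module.finrank 𝕜 (Module.End.eigenspace (T y) (hT.eigenvalue hn i y : 𝕜)) =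
      Module.finrank 𝕜 (Module.End.eigenspace (T x) (hT.eigenvalue hn i x : 𝕜)))
    {u : E} (hu : hT.IsUnitEigenvector hn i x u) {g : X →L[ℝ] ℝ}
    (hg : ∀ d, g d = RCLike.re ⟪u, B d u⟫) : HasFDerivAt (hT.eigenvalue hn i) g x := by
  obtain ⟨w, hw, hweig⟩ := hT.exists_tendsto_eigenvector hn i hmult hu.2
  rw [hasFDerivAt_iff_isLittleO, Asymptotics.isLittleO_iff]
  intro c hc
  have hcoef : Tendsto (fun y => ‖w y - u‖ * ‖B‖ + ‖B‖ * |1 - RCLike.re ⟪w y, u⟫|) (𝓝 x) (𝓝 0) := by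
    have h1 : Tendsto (fun y => ‖w y - u‖) (𝓝 x) (𝓝 0) := tendsto_iff_norm_sub_tendsto_zero.1 hw
    have h2 : Tendsto (fun y => |1 - RCLike.re ⟪w y, u⟫|) (𝓝 x) (𝓝 |1 - RCLike.re ⟪u, u⟫|) :=
      (((RCLike.continuous_re.tendsto _).comp
        (hw.inner (tendsto_const_nhds (x := u)))).const_sub 1).abs
    have h3 : |1 - RCLike.re ⟪u, u⟫| = 0 := by
      rw [inner_self_eq_norm_sq, hu.1]; simp
    rw [h3] at h2
    simpa using (h1.mul_const ‖B‖).add (h2.const_mul ‖B‖)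
  filter_upwards [hweig, hcoef.eventually_le_const hc] with y hy hcy
  have key : RCLike.re ⟪w y, B (y - x) u⟫ =
      (hT.eigenvalue hn i y - hT.eigenvalue hn i x) * RCLike.re ⟪w y, u⟫ := by
    have h1 : ⟪w y, T y u⟫ = (hT.eigenvalue hn i y : 𝕜) * ⟪w y, u⟫ := by
      rw [← hT.isSymmetric y, hy, inner_smul_left, RCLike.conj_ofReal]
    rw [hT.apply_sub x y, inner_add_right, hu.2, inner_smul_right] at h1
    have h2 := congrArg RCLike.re h1
    simp only [map_add, RCLike.re_ofReal_mul] at h2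
    linarith
  -- Both terms are o(‖y - x‖): the first through w(y) → u, the second by the Lipschitz bound and
  -- ⟨w(y), u⟩ → 1.
  have hsplit : hT.eigenvalue hn i y - hT.eigenvalue hn i x - g (y - x) =
      RCLike.re ⟪w y - u, B (y - x) u⟫ +
        (hT.eigenvalue hn i y - hT.eigenvalue hn i x) * (1 - RCLike.re ⟪w y, u⟫) := by
    rw [hg, inner_sub_left, AddMonoidHom.map_sub, key]; ring
  have hlip : |hT.eigenvalue hn i y - hT.eigenvalue hn i x| ≤ ‖B‖ * ‖y - x‖ := by
    simpa [Real.norm_eq_abs] using (hT.lipschitzWith_eigenvalue hn i).norm_sub_le y x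
  have hB := norm_re_inner_le B (y - x) (w y - u) u
  rw [hu.1, mul_one] at hB
  rw [hsplit, Real.norm_eq_abs]
  calc _ ≤ _ := abs_add_le _ _
    _ ≤ ‖w y - u‖ * (‖B‖ * ‖y - x‖) + ‖B‖ * ‖y - x‖ * |1 - RCLike.re ⟪w y, u⟫| := by
        rw [abs_mul]; gcongr
    _ = (‖w y - u‖ * ‖B‖ + ‖B‖ * |1 - RCLike.re ⟪w y, u⟫|) * ‖y - x‖ := by ring
    _ ≤ c * ‖y - x‖ := by gcongr

end IsAffineSymmetricFamily

end AffineFamily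

/-! ### Application to the matrix pencils -/

namespace MEP

variable {m : ℕ} {n : Fin m → ℕ}
  {A : (k : Fin m) → Fin (m + 1) → Matrix (Fin (n k)) (Fin (n k)) ℂ}

/-- The linear part `x ↦ ∑ x_ℓ A_{kℓ}` of the pencil, as a family of operators. -/
noncomputable def linearPart (A : (k : Fin m) → Fin (m + 1) → Matrix (Fin (n k)) (Fin (n k)) ℂ)
    (k : Fin m) : EuclideanSpace ℝ (Fin m) →L[ℝ]
      (EuclideanSpace ℂ (Fin (n k)) →L[ℂ] EuclideanSpace ℂ (Fin (n k))) :=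
  ∑ l : Fin m, (EuclideanSpace.proj l : EuclideanSpace ℝ (Fin m) →L[ℝ] ℝ).smulRight
    (Matrix.toEuclideanCLM (𝕜 := ℂ) (A k l.succ))

theorem linearPart_apply (k : Fin m) (d : EuclideanSpace ℝ (Fin m))
    (u : EuclideanSpace ℂ (Fin (n k))) :
    linearPart A k d u = ∑ l, (d l : ℂ) • Matrix.toEuclideanLin (A k l.succ) u := by
  simp only [linearPart, sum_apply, ContinuousLinearMap.smulRight_apply,
    smul_apply, PiLp.proj_apply, Complex.coe_smul]
  rfl

theorem isAffineSymmetricFamily (hA : ∀ k l, (A k l).IsHermitian) (k : Fin m) :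
    IsAffineSymmetricFamily (fun x => Matrix.toEuclideanLin (pencil A k x)) (linearPart A k) where
  isSymmetric x := Matrix.isSymmetric_toEuclideanLin_iff.2 (isHermitian_pencil hA k x)
  apply_sub x y v := by
    simp only [linearPart_apply, pencil, map_add, map_sum, map_smul, LinearMap.add_apply,
      LinearMap.sum_apply, LinearMap.smul_apply, PiLp.sub_apply, Complex.ofReal_sub, sub_smul,
      Finset.sum_sub_distrib]
    abel

theorem toEuclideanLin_eq_smul_iff {p : ℕ} (M : Matrix (Fin p) (Fin p) ℂ) (c : ℂ)
    (u : EuclideanSpace ℂ (Fin p)) :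
    Matrix.toEuclideanLin M u = c • u ↔ M *ᵥ u.ofLp = c • u.ofLp := by
  rw [← (WithLp.ofLp_injective 2).eq_iff]
  rfl

theorem isUnitEigenvectors_iff (hA : ∀ k l, (A k l).IsHermitian) (i : (k : Fin m) → Fin (n k))
    (x : EuclideanSpace ℝ (Fin m)) (u : (k : Fin m) → EuclideanSpace ℂ (Fin (n k))) :
    IsUnitEigenvectors hA i x u ↔ ∀ k, (isAffineSymmetricFamily hA k).IsUnitEigenvector
      finrank_euclideanSpace (Fin.cast (Fintype.card_fin (n k)).symm (i k)) x (u k) :=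
  forall_congr' fun _ => and_congr_right fun _ => (toEuclideanLin_eq_smul_iff _ _ _).symm

theorem multiplicity_eq (hA : ∀ k l, (A k l).IsHermitian) (k : Fin m) (i : Fin (n k))
    (x : EuclideanSpace ℝ (Fin m)) :
    multiplicity hA k i x = Module.finrank ℂ (Module.End.eigenspace
      (Matrix.toEuclideanLin (pencil A k x)) ((eps hA k i x : ℝ) : ℂ)) := by
  refine (LinearEquiv.finrank_eq (LinearEquiv.ofSubmodules (WithLp.linearEquiv 2 ℂ _) _ _ ?_)).symm
  ext v
  rw [Submodule.mem_map_equiv, Module.End.mem_eigenspace_iff, Module.End.mem_eigenspace_iff,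
    toEuclideanLin_eq_smul_iff]
  rfl

/-- The row of `formMatrix` contributed by a single vector. -/
noncomputable def formRow (A : (k : Fin m) → Fin (m + 1) → Matrix (Fin (n k)) (Fin (n k)) ℂ)
    (k : Fin m) (u : EuclideanSpace ℂ (Fin (n k))) (l : Fin m) : ℝ :=
  (star u.ofLp ⬝ᵥ (A k l.succ *ᵥ u.ofLp)).re

theorem re_inner_linearPart (k : Fin m) (d : EuclideanSpace ℝ (Fin m))
    (u : EuclideanSpace ℂ (Fin (n k))) :
    RCLike.re (inner ℂ u (linearPart A k d u)) = ∑ l, d l * formRow A k u l := by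
  rw [linearPart_apply, inner_sum, map_sum]
  refine Finset.sum_congr rfl fun l _ => ?_
  rw [inner_smul_right, EuclideanSpace.inner_eq_star_dotProduct, dotProduct_comm]
  exact Complex.re_ofReal_mul _ _

theorem continuous_formRow (k : Fin m) : Continuous (formRow A k) := by
  unfold formRow
  fun_prop

theorem hasFDerivAt_eps (hA : ∀ k l, (A k l).IsHermitian) (i : (k : Fin m) → Fin (n k))
    {x : EuclideanSpace ℝ (Fin m)} (h : DifferentiableAt ℝ (F hA i) x) (k : Fin m) :
    HasFDerivAt (eps hA k (i k)) (EuclideanSpace.proj k ∘L fderiv ℝ (F hA i) x) x :=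
  (EuclideanSpace.proj k : EuclideanSpace ℝ (Fin m) →L[ℝ] ℝ).hasFDerivAt.comp x h.hasFDerivAt

theorem exists_lipschitzWith_F (hA : ∀ k l, (A k l).IsHermitian) (i : (k : Fin m) → Fin (n k)) :
    ∃ K : NNReal, LipschitzWith K (F hA i) := by
  have h : LipschitzWith (Finset.univ.sup fun k => ‖linearPart A k‖₊)
      fun x k => eps hA k (i k) x :=
    LipschitzWith.of_dist_le_mul fun x y => (dist_pi_le_iff (by positivity)).2 fun k =>
      (((isAffineSymmetricFamily hA k).lipschitzWith_eigenvalue _ _).weaken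
        (Finset.le_sup (f := fun k => ‖linearPart A k‖₊) (Finset.mem_univ k))).dist_le_mul x y
  exact ⟨_, (PiLp.lipschitzWith_toLp 2 _).comp h⟩

theorem differentiableAt_F (hA : ∀ k l, (A k l).IsHermitian) (i : (k : Fin m) → Fin (n k))
    {x : EuclideanSpace ℝ (Fin m)}
    (hmult : ∀ k, ∀ᶠ y in 𝓝 x, multiplicity hA k (i k) y = multiplicity hA k (i k) x)
    {u : (k : Fin m) → EuclideanSpace ℂ (Fin (n k))} (hu : IsUnitEigenvectors hA i x u) :
    DifferentiableAt ℝ (F hA i) x ∧ jacobianMatrix (F hA i) x = formMatrix A u := by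
  let g (k : Fin m) : EuclideanSpace ℝ (Fin m) →L[ℝ] ℝ :=
    ∑ l, formRow A k (u k) l • (EuclideanSpace.proj l : EuclideanSpace ℝ (Fin m) →L[ℝ] ℝ)
  have hg (k : Fin m) (d : EuclideanSpace ℝ (Fin m)) :
      g k d = ∑ l, d l * formRow A k (u k) l := by
    simp [g, mul_comm]
  have hderiv (k : Fin m) : HasFDerivAt (eps hA k (i k)) (g k) x := by
    refine (isAffineSymmetricFamily hA k).hasFDerivAt_eigenvalue _ _ ?_
      ((isUnitEigenvectors_iff hA i x u).1 hu k) fun d => ?_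
    · have h := hmult k
      simp only [multiplicity_eq] at h
      exact h
    · rw [hg, re_inner_linearPart]
  have hdiff : DifferentiableAt ℝ (F hA i) x :=
    (differentiableAt_euclidean).2 fun k => (hderiv k).differentiableAt
  refine ⟨hdiff, ?_⟩
  ext k l
  have h1 := (hasFDerivAt_eps hA i hdiff k).unique (hderiv k)
  have h2 := congrArg (fun f => f (EuclideanSpace.single l 1)) h1
  refine h2.trans ?_
  rw [hg]
  simp [formRow, formMatrix]

/-- Each direction `d` has its own dominating eigenvector at `x`; compactness of the set of rows
permits separation. -/
theorem row_mem_convexHull (hA : ∀ k l, (A k l).IsHermitian) (i : (k : Fin m) → Fin (n k))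
    {x : EuclideanSpace ℝ (Fin m)} {y : ℕ → EuclideanSpace ℝ (Fin m)}
    {J : Matrix (Fin m) (Fin m) ℝ} (hdiff : ∀ j, DifferentiableAt ℝ (F hA i) (y j))
    (hy : Tendsto y atTop (𝓝 x))
    (hJ : Tendsto (fun j => jacobianMatrix (F hA i) (y j)) atTop (𝓝 J)) (k : Fin m) :
    J k ∈ convexHull ℝ (formRow A k '' {u | (isAffineSymmetricFamily hA k).IsUnitEigenvector
      finrank_euclideanSpace (Fin.cast (Fintype.card_fin (n k)).symm (i k)) x u}) := by
  refine mem_convexHull_of_forall_exists_le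
    (((isAffineSymmetricFamily hA k).isCompact_setOf_isUnitEigenvector _ _ x).image
      (continuous_formRow k)) fun d => ?_
  have hderiv (j : ℕ) := hasFDerivAt_eps hA i (hdiff j) k
  have hd (j : ℕ) : (EuclideanSpace.proj k ∘L fderiv ℝ (F hA i) (y j)) (WithLp.toLp 2 d) =
      ∑ l, d l * jacobianMatrix (F hA i) (y j) k l := by
    have : WithLp.toLp 2 d = ∑ l, d l • EuclideanSpace.single l (1 : ℝ) := by
      ext l
      simp [Finset.sum_apply, Pi.single_apply]
    rw [this, map_sum]
    simp [jacobianMatrix]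
  have hlim : Tendsto (fun j => (EuclideanSpace.proj k ∘L fderiv ℝ (F hA i) (y j))
      (WithLp.toLp 2 d)) atTop (𝓝 (∑ l, d l * J k l)) := by
    simp only [hd]
    exact tendsto_finsetSum _ fun l _ =>
      (tendsto_pi_nhds.1 (tendsto_pi_nhds.1 hJ k) l).const_mul (d l)
  obtain ⟨u, hu, hle⟩ :=
    (isAffineSymmetricFamily hA k).exists_le_of_tendsto _ _ hderiv hy hlim
  refine ⟨_, ⟨u, hu, rfl⟩, ?_⟩
  rwa [re_inner_linearPart] at hle

theorem clarkeJacobian_F_subset (hA : ∀ k l, (A k l).IsHermitian) (i : (k : Fin m) → Fin (n k))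
    (x : EuclideanSpace ℝ (Fin m)) :
    clarkeJacobian (F hA i) x ⊆ convexHull ℝ {J | ∃ u : (k : Fin m) → EuclideanSpace ℂ (Fin (n k)),
      IsUnitEigenvectors hA i x u ∧ J = formMatrix A u} := by
  refine convexHull_min ?_ (convex_convexHull ℝ _)
  rintro J ⟨y, hdiff, hy, hJ⟩
  -- No coupling between different `k` remains, so rowwise membership suffices.
  have hmem := mem_convexHull_pi (s := Set.univ) (x := (J : Fin m → Fin m → ℝ))
    fun k _ => row_mem_convexHull hA i hdiff hy hJ k
  refine convexHull_mono ?_ hmem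
  intro J' hJ'
  choose u hu hrow using fun k => hJ' k trivial
  exact ⟨u, (isUnitEigenvectors_iff hA i x u).2 hu, funext fun k => (hrow k).symm⟩

end MEP

theorem mainTheorem5 {m : ℕ} {n : Fin m → ℕ}
    (A : (k : Fin m) → Fin (m + 1) → Matrix (Fin (n k)) (Fin (n k)) ℂ)
    (hA : ∀ k l, (A k l).IsHermitian) (i : (k : Fin m) → Fin (n k)) :
    -- `F_𝐢` is Lipschitz, so that its generalized Jacobian is defined
    (∃ K : NNReal, LipschitzWith K (MEP.F hA i)) ∧
    -- differentiability and the Jacobian where the multiplicities are locally constant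
    (∀ x : EuclideanSpace ℝ (Fin m),
      (∀ k, ∀ᶠ y in 𝓝 x, MEP.multiplicity hA k (i k) y = MEP.multiplicity hA k (i k) x) →
      DifferentiableAt ℝ (MEP.F hA i) x ∧
      ∀ u : (k : Fin m) → EuclideanSpace ℂ (Fin (n k)), MEP.IsUnitEigenvectors hA i x u →
        jacobianMatrix (MEP.F hA i) x = MEP.formMatrix A u) ∧
    -- the generalized Jacobian at an arbitrary point
    (∀ x : EuclideanSpace ℝ (Fin m),
      clarkeJacobian (MEP.F hA i) x ⊆
        convexHull ℝ {J | ∃ u : (k : Fin m) → EuclideanSpace ℂ (Fin (n k)),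
          MEP.IsUnitEigenvectors hA i x u ∧ J = MEP.formMatrix A u}) := by
  refine ⟨MEP.exists_lipschitzWith_F hA i, fun x hmult => ⟨?_, fun u hu => ?_⟩,
    MEP.clarkeJacobian_F_subset hA i⟩
  -- Differentiability is claimed without a given `u`, so eigenvectors must first be exhibited.
  · choose u hu using fun k => (MEP.isAffineSymmetricFamily hA k).exists_isUnitEigenvector
      finrank_euclideanSpace (Fin.cast (Fintype.card_fin (n k)).symm (i k)) x
    exact (MEP.differentiableAt_F hA i hmult ((MEP.isUnitEigenvectors_iff hA i x u).2 hu)).1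
  · exact (MEP.differentiableAt_F hA i hmult hu).2
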